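/- A smooth Fano polytope in $\mathbb R^d$ is a polytope $P\subset\mathbb R^d$ with vertices in $\mathbb Z^d$ that contains the origin in its interior and such that the vertices of every facet of $P$ form a lattice basis of $\mathbb Z^d$. For $P\subset\mathbb R^a$ and $Q\subset\mathbb R^b$ containing the origin in their interiors, the free sum is $$P\oplus Q=\mathrm{conv}\big((P\times\{0\})\cup(\{0\}\times Q)\big)\subset\mathbb R^{a+b}.$$ The smooth bipyramid over $P\subset\mathbb R^a$ is $P\oplus[-1,1]$. For a vertex $v$ of $P$, the smooth skew bipyramid over $P$ for $v$ is $$\mathrm{conv}\big((P\times\{0\})\cup\{-e_{a+1},\,(v,0)+e_{a+1}\}\big)\subset\mathbb R^{a+1}.$$ A smooth generalized skew bipyramid over $P$ is a polytope $$R=\mathrm{conv}\big((P\times\{0\})\cup\{u,w\}\big)\subset\mathbb R^{a+1},$$ where $u,w\in\mathbb Z^{a+1}$ have lattice distance $1$ from the hyperplane $\mathbb R^a\times\{0\}$ (i.e. last coordinate $\pm1$), such that for some segment $S=[-s,t]$ with $s,t>0$ there is an isomorphism from the face lattice of the bipyramid $P\oplus S$ onto the face lattice of $R$ that maps the vertices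 $(0,t)$ and $(0,-s)$ to the apices $u$ and $w$. Proposition. Let $P\subset\mathbb R^a$ and $Q\subset\mathbb R^b$ be smooth Fano polytopes. Then the free sum $P\oplus Q$, the smooth bipyramid over $P$, the smooth skew bipyramid over $P$ for any vertex $v$ of $P$, and any smooth generalized skew bipyramid over $P$ are again smooth Fano polytopes. -/

import Mathlib

/-- The integer lattice `ℤ^d` inside `ℝ^d`. -/
def intLattice (d : ℕ) : Submodule ℤ (Fin d → ℝ) :=
  Submodule.span ℤ (Set.range fun i : Fin d => (Pi.single i 1 : Fin d → ℝ))

/-- A set `V` of vectors is a lattice basis of `ℤ^d`. -/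
def IsLatticeBasis {d : ℕ} (V : Set (Fin d → ℝ)) : Prop :=
  LinearIndepOn ℤ id V ∧ Submodule.span ℤ V = intLattice d

/-- A polytope is the convex hull of finitely many points. -/
def IsPolytope {d : ℕ} (P : Set (Fin d → ℝ)) : Prop :=
  ∃ V : Set (Fin d → ℝ), V.Finite ∧ P = convexHull ℝ V

/-- The vertices of a polytope. -/
def vertices {d : ℕ} (P : Set (Fin d → ℝ)) : Set (Fin d → ℝ) :=
  P.extremePoints ℝ

/-- The face lattice of `P`: all faces of `P`, including `∅` and `P` itself, ordered by inclusion.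
A nonempty face is the set of points of `P` at which some linear functional attains its maximum
over `P`. -/
abbrev FaceLattice {d : ℕ} (P : Set (Fin d → ℝ)) : Type :=
  {F : Set (Fin d → ℝ) // IsExposed ℝ P F}

/-- A facet is an inclusion-maximal proper face. -/
def IsFacet {d : ℕ} (P F : Set (Fin d → ℝ)) : Prop :=
  Maximal (fun G : Set (Fin d → ℝ) => IsExposed ℝ P G ∧ G ≠ P) F

/-- A smooth Fano polytope in `ℝ^d`: a lattice polytope with the origin in its interior (so it is
full-dimensional) such that the vertices of every facet form a lattice basis of `ℤ^d`. -/
structure IsSmoothFano {d : ℕ} (P : Set (Fin d → ℝ)) : Prop where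
  isPolytope : IsPolytope P
  vertices_subset : vertices P ⊆ intLattice d
  zero_mem_interior : (0 : Fin d → ℝ) ∈ interior P
  isLatticeBasis_facet : ∀ F, IsFacet P F → IsLatticeBasis (vertices F)

/-- The free sum `P ⊕ Q = conv (P × {0} ∪ {0} × Q)` in `ℝ^(a+b)`. -/
def freeSum {a b : ℕ} (P : Set (Fin a → ℝ)) (Q : Set (Fin b → ℝ)) : Set (Fin (a + b) → ℝ) :=
  convexHull ℝ ((fun v => Fin.append v (0 : Fin b → ℝ)) '' P ∪
    (fun w => Fin.append (0 : Fin a → ℝ) w) '' Q)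

/-- The point `(x, h)` of `ℝ^(d+1)`. -/
def pt {d : ℕ} (x : Fin d → ℝ) (h : ℝ) : Fin (d + 1) → ℝ :=
  Fin.append x (fun _ : Fin 1 => h)

/-- The segment `[l, u]` in `ℝ^1`. -/
def seg (l u : ℝ) : Set (Fin 1 → ℝ) :=
  Set.Icc (fun _ => l) (fun _ => u)

/-- The smooth bipyramid over `P`, the free sum of `P` with `[-1, 1]`. -/
def smoothBipyramid {d : ℕ} (P : Set (Fin d → ℝ)) : Set (Fin (d + 1) → ℝ) :=
  freeSum P (seg (-1) 1)

/-- The smooth skew bipyramid over `P` for the vertex `v`, that is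
`conv (P × {0} ∪ {-e_{d+1}, (v, 0) + e_{d+1}})`. -/
def smoothSkewBipyramid {d : ℕ} (P : Set (Fin d → ℝ)) (v : Fin d → ℝ) :
    Set (Fin (d + 1) → ℝ) :=
  convexHull ℝ ((fun x => pt x 0) '' P ∪ {pt 0 (-1), pt v 1})

/-- `R` is a skew bipyramid over `P` with apices `u` and `w`: `R` is the convex hull of
`P × {0}`, `u` and `w`, and there is an isomorphism from the face lattice of a bipyramid over `P`,
the free sum of `P` with a segment `[-s, t]` containing `0` in its interior, onto the face lattice
of `R` which maps the two vertices coming from the segment to `u` and `w`. -/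
def IsSkewBipyramid {d : ℕ} (P : Set (Fin d → ℝ)) (R : Set (Fin (d + 1) → ℝ))
    (u w : Fin (d + 1) → ℝ) : Prop :=
  R = convexHull ℝ ((fun x => pt x 0) '' P ∪ {u, w}) ∧
  ∃ s t : ℝ, 0 < s ∧ 0 < t ∧
    ∃ φ : FaceLattice (freeSum P (seg (-s) t)) ≃o FaceLattice R,
      (∃ T, T.1 = {pt 0 t} ∧ (φ T).1 = {u}) ∧ (∃ B, B.1 = {pt 0 (-s)} ∧ (φ B).1 = {w})

/-- The lattice distance of a lattice point of `ℝ^(d+1)` from the hyperplane `ℝ^d × {0}`, whose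
primitive integral normal is the last coordinate functional. -/
def latticeDistBase {d : ℕ} (x : Fin (d + 1) → ℝ) : ℝ :=
  |x (Fin.last d)|

/-- `R` is a smooth generalized skew bipyramid over `P`: a skew bipyramid whose apices are lattice
points at lattice distance `1` from (the hyperplane spanned by) `P × {0}`. -/
def IsSmoothGeneralizedSkewBipyramid {d : ℕ} (P : Set (Fin d → ℝ))
    (R : Set (Fin (d + 1) → ℝ)) : Prop :=
  ∃ u w : Fin (d + 1) → ℝ, IsSkewBipyramid P R u w ∧
    u ∈ intLattice (d + 1) ∧ w ∈ intLattice (d + 1) ∧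
    latticeDistBase u = 1 ∧ latticeDistBase w = 1

/-! Since the origin is interior, every proper face is cut out by `l = 1` for a functional `l ≤ 1`.
Smoothness thus becomes the condition `HasUnimodularFaces` on a finite generating set: every such
`l` can be replaced by some `l'` that keeps its contact points and whose contact set is a lattice
basis. The vertices of a smooth Fano polytope satisfy it (`IsSmoothFano.hasUnimodularFaces`), and it
suffices for smoothness (`isSmoothFano_convexHull`), so no list of facets is ever needed.

For a free sum, `l` is restricted to both summands, each restriction is enlarged, and the results
are added.

All bipyramids have apices `(x, 1)` and `(y, -1)`. If `(x + y) / 2` is interior to `P`, then `l x +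
l y < 2` whenever `l ≤ 1` on `P`. Hence a facet functional of `P` lifts to one that touches exactly
one chosen apex, and a base facet with an apex at height `±1` gives a lattice basis. The midpoint is
`0` for the bipyramid and `v / 2` for the skew one. In the generalized case the face lattice
isomorphism forbids a proper face through both apices, whereas a non-interior midpoint, or apices on
the same side, would produce one. -/

/-! ### Lattice points and lattice bases. -/

theorem intLattice_eq_span_basisFun (d : ℕ) :
    intLattice d = Submodule.span ℤ (Set.range (Pi.basisFun ℝ (Fin d))) := by
  unfold intLattice
  congr 2
  funext i
  simp

theorem mem_intLattice_iff {d : ℕ} {x : Fin d → ℝ} :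
    x ∈ intLattice d ↔ ∀ i, ∃ n : ℤ, x i = n := by
  rw [intLattice_eq_span_basisFun, Module.Basis.mem_span_iff_repr_mem]
  simp [eq_comm]

/-- Independence over `ℤ` alone would not give this (take `1` and `√2`); it holds because the span
is a full lattice. -/
theorem IsLatticeBasis.linearIndepOn_real {d : ℕ} {B : Set (Fin d → ℝ)}
    (hB : IsLatticeBasis B) : LinearIndepOn ℝ id B := by
  have hspan : Submodule.span ℤ (Set.range fun x : B => (x : Fin d → ℝ)) =
      Submodule.span ℤ (Set.range (Pi.basisFun ℝ (Fin d))) := by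
    rw [Subtype.range_coe, hB.2, intLattice_eq_span_basisFun]
  have hli : LinearIndependent ℤ fun x : B => (x : Fin d → ℝ) := hB.1
  let c : Module.Basis B ℤ (Submodule.span ℤ (Set.range (Pi.basisFun ℝ (Fin d)))) :=
    (Module.Basis.span hli).map (LinearEquiv.ofEq _ _ hspan)
  have h := (c.ofZLatticeBasis ℝ).linearIndependent
  have hc : ⇑(c.ofZLatticeBasis ℝ) = fun x : B => (x : Fin d → ℝ) := by
    funext x
    simp [c, Module.Basis.span_apply]
  rwa [hc] at h

/-! ### Exposed faces of polytopes. -/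

/-- A linear functional that is maximal over `A` at an interior point vanishes. -/
theorem ContinuousLinearMap.eq_zero_of_le_of_mem_interior {E : Type*} [NormedAddCommGroup E]
    [NormedSpace ℝ E] {A : Set E} {l : E →L[ℝ] ℝ} {z : E} (hz : z ∈ interior A)
    (hl : ∀ y ∈ A, l y ≤ l z) : l = 0 := by
  have h : IsLocalMax l z :=
    Filter.mem_of_superset (mem_interior_iff_mem_nhds.1 hz) hl
  simpa using h.fderiv_eq_zero

theorem IsExposed.eq_of_mem_interior {E : Type*} [NormedAddCommGroup E]
    [NormedSpace ℝ E] {A G : Set E} (hG : IsExposed ℝ A G) {z : E} (hzG : z ∈ G)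
    (hz : z ∈ interior A) : G = A := by
  obtain ⟨l, rfl⟩ := hG ⟨z, hzG⟩
  have := ContinuousLinearMap.eq_zero_of_le_of_mem_interior hz hzG.2
  ext x
  simp [this]

/-- The part of `A` in the hyperplane `l = 1` is an exposed face if `l ≤ 1` on `A`. -/
theorem isExposed_setOf_eq_one {E : Type*} [NormedAddCommGroup E] [NormedSpace ℝ E] {A : Set E}
    {l : E →L[ℝ] ℝ} (hl : ∀ x ∈ A, l x ≤ 1) : IsExposed ℝ A {x ∈ A | l x = 1} := by
  rintro ⟨z, hzA, hz⟩
  refine ⟨l, ?_⟩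
  ext x
  refine and_congr_right fun hx => ⟨fun h y hy => h ▸ hl y hy, fun h => ?_⟩
  exact le_antisymm (hl x hx) (hz ▸ h z hzA)

/-- Proper exposed faces of a set with the origin in its interior are cut out by `l = 1`. -/
theorem IsExposed.exists_eq_setOf_eq_one {E : Type*} [NormedAddCommGroup E] [NormedSpace ℝ E]
    {A F : Set E} (h0 : (0 : E) ∈ interior A) (hF : IsExposed ℝ A F) (hne : F ≠ A) :
    ∃ l : E →L[ℝ] ℝ, (∀ x ∈ A, l x ≤ 1) ∧ F = {x ∈ A | l x = 1} := by
  rcases F.eq_empty_or_nonempty with rfl | hn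
  · exact ⟨0, by simp, by simp⟩
  obtain ⟨l, hl⟩ := hF hn
  obtain ⟨z, hz⟩ := hn
  have hz' := hz
  rw [hl] at hz'
  have h0A := interior_subset h0
  have hpos : 0 < l z := by
    refine lt_of_le_of_ne (by simpa using hz'.2 0 h0A) fun h => hne ?_
    have : l = 0 := ContinuousLinearMap.eq_zero_of_le_of_mem_interior h0
      (fun y hy => by simpa [← h] using hz'.2 y hy)
    rw [hl, this]
    simp
  refine ⟨(l z)⁻¹ • l, fun x hx => ?_, ?_⟩
  · have := hz'.2 x hx
    simp only [smul_apply, smul_eq_mul]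
    rwa [inv_mul_le_one₀ hpos]
  · rw [hl]
    ext x
    refine and_congr_right fun hx => ?_
    simp only [smul_apply, smul_eq_mul]
    rw [inv_mul_eq_one₀ hpos.ne']
    exact ⟨fun h => le_antisymm (h z hz'.1) (hz'.2 x hx), fun h y hy => h ▸ hz'.2 y hy⟩

theorem le_of_mem_convexHull {E : Type*} [NormedAddCommGroup E] [NormedSpace ℝ E]
    {S : Set E} {l : E →L[ℝ] ℝ} {c : ℝ} (hl : ∀ x ∈ S, l x ≤ c) {x : E}
    (hx : x ∈ convexHull ℝ S) : l x ≤ c :=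
  convexHull_min (t := {x | l x ≤ c}) hl (convex_halfSpace_le l.toLinearMap.isLinear c) hx

theorem vertices_convexHull_subset {d : ℕ} (S : Set (Fin d → ℝ)) :
    vertices (convexHull ℝ S) ⊆ S :=
  extremePoints_convexHull_subset

/-- An exposed face of a polytope is the convex hull of its vertices. -/
theorem IsExposed.convexHull_vertices {d : ℕ} {S F : Set (Fin d → ℝ)} (hS : S.Finite)
    (hF : IsExposed ℝ (convexHull ℝ S) F) : convexHull ℝ (vertices F) = F := by
  have hsub : F.extremePoints ℝ ⊆ S :=
    hF.isExtreme.extremePoints_subset_extremePoints.trans extremePoints_convexHull_subset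
  have := closure_convexHull_extremePoints (hF.isCompact (hS.isCompact_convexHull (𝕜 := ℝ)))
    (hF.convex (convex_convexHull ℝ S))
  rwa [((hS.subset hsub).isClosed_convexHull (𝕜 := ℝ)).closure_eq] at this

theorem IsExposed.vertices_eq {d : ℕ} {P F : Set (Fin d → ℝ)} (hF : IsExposed ℝ P F) :
    vertices F = F ∩ vertices P :=
  hF.isExtreme.extremePoints_eq

/-- A face is determined by its vertices, which form a subset of `S`. Finiteness is what places
every proper face inside a facet. -/
theorem finite_setOf_isExposed_convexHull {d : ℕ} {S : Set (Fin d → ℝ)} (hS : S.Finite) :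
    {F | IsExposed ℝ (convexHull ℝ S) F}.Finite := by
  refine (hS.powerset).of_injOn (f := vertices) (fun F hF => ?_) fun F hF G hG h => ?_
  · exact hF.isExtreme.extremePoints_subset_extremePoints.trans extremePoints_convexHull_subset
  · rw [← IsExposed.convexHull_vertices hS hF, ← IsExposed.convexHull_vertices hS hG, h]

/-! ### The unimodular contact criterion for smoothness. -/

/-- Every face of `conv S` that misses the origin lies in a face `l = 1` in which the points of `S`
form a lattice basis. -/
def HasUnimodularFaces {d : ℕ} (S : Set (Fin d → ℝ)) : Prop :=
  ∀ l : (Fin d → ℝ) →L[ℝ] ℝ, (∀ s ∈ S, l s ≤ 1) →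
    ∃ l' : (Fin d → ℝ) →L[ℝ] ℝ, (∀ s ∈ S, l' s ≤ 1) ∧ (∀ s ∈ S, l s = 1 → l' s = 1) ∧
      IsLatticeBasis {s ∈ S | l' s = 1}

theorem IsSmoothFano.vertices_finite {d : ℕ} {P : Set (Fin d → ℝ)} (hP : IsSmoothFano P) :
    (vertices P).Finite := by
  obtain ⟨S, hS, rfl⟩ := hP.isPolytope
  exact hS.subset (vertices_convexHull_subset S)

theorem IsSmoothFano.convexHull_vertices {d : ℕ} {P : Set (Fin d → ℝ)} (hP : IsSmoothFano P) :
    convexHull ℝ (vertices P) = P := by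
  obtain ⟨S, hS, rfl⟩ := hP.isPolytope
  exact (IsExposed.refl _).convexHull_vertices hS

theorem IsSmoothFano.convex {d : ℕ} {P : Set (Fin d → ℝ)} (hP : IsSmoothFano P) :
    Convex ℝ P :=
  hP.convexHull_vertices ▸ convex_convexHull ℝ _

theorem IsSmoothFano.hasUnimodularFaces {d : ℕ} {P : Set (Fin d → ℝ)} (hP : IsSmoothFano P) :
    HasUnimodularFaces (vertices P) := by
  intro l hl
  have hlP : ∀ x ∈ P, l x ≤ 1 := fun x hx =>
    le_of_mem_convexHull hl (hP.convexHull_vertices.symm ▸ hx)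
  have h0 := interior_subset hP.zero_mem_interior
  have hfin : {G | IsExposed ℝ P G ∧ G ≠ P}.Finite := by
    obtain ⟨S, hS, rfl⟩ := hP.isPolytope
    exact (finite_setOf_isExposed_convexHull hS).subset fun G hG => hG.1
  have hmem : {x ∈ P | l x = 1} ∈ {G | IsExposed ℝ P G ∧ G ≠ P} := by
    refine ⟨isExposed_setOf_eq_one hlP, fun h => ?_⟩
    have := h.symm ▸ h0
    simpa using this.2
  obtain ⟨G, hle, hG⟩ := hfin.exists_le_maximal hmem
  have hGf : IsFacet P G := hG
  obtain ⟨l', hl', rfl⟩ :=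
    hG.prop.1.exists_eq_setOf_eq_one hP.zero_mem_interior hG.prop.2
  refine ⟨l', fun s hs => hl' s hs.1, fun s hs h => (hle ⟨hs.1, h⟩).2, ?_⟩
  have := hP.isLatticeBasis_facet _ hGf
  rw [hG.prop.1.vertices_eq] at this
  convert this using 1
  ext x
  exact ⟨fun h => ⟨⟨h.1.1, h.2⟩, h.1⟩, fun h => ⟨h.2, h.1.2⟩⟩

theorem isSmoothFano_convexHull {d : ℕ} {S : Set (Fin d → ℝ)} (hS : S.Finite)
    (hSL : S ⊆ intLattice d) (h0 : (0 : Fin d → ℝ) ∈ interior (convexHull ℝ S))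
    (hU : HasUnimodularFaces S) : IsSmoothFano (convexHull ℝ S) := by
  refine ⟨⟨S, hS, rfl⟩, (vertices_convexHull_subset S).trans hSL, h0, fun F hF => ?_⟩
  obtain ⟨l, hl, hFl⟩ := hF.prop.1.exists_eq_setOf_eq_one h0 hF.prop.2
  obtain ⟨l', hl', hll', hB⟩ := hU l fun s hs => hl s (subset_convexHull ℝ S hs)
  set G := {x ∈ convexHull ℝ S | l' x = 1}
  have hG : IsExposed ℝ (convexHull ℝ S) G :=
    isExposed_setOf_eq_one fun x hx => le_of_mem_convexHull hl' hx
  have hvG : vertices G ⊆ {s ∈ S | l' s = 1} := by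
    rw [hG.vertices_eq]
    exact fun x hx => ⟨vertices_convexHull_subset S hx.2, hx.1.2⟩
  have hFG : F ⊆ G := by
    rw [← hF.prop.1.convexHull_vertices hS]
    refine convexHull_min (fun x hx => ?_) (hG.convex (convex_convexHull ℝ S))
    rw [hF.prop.1.vertices_eq] at hx
    have hxF := hx.1
    rw [hFl] at hxF
    exact ⟨hxF.1, hll' x (vertices_convexHull_subset S hx.2) hxF.2⟩
  have hFG' : F = G := by
    refine hF.eq_of_le ⟨hG, fun h => ?_⟩ hFG
    have := h.symm ▸ interior_subset h0
    simpa using this.2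
  rw [hFG']
  suffices vertices G = {s ∈ S | l' s = 1} by rwa [this]
  -- A basis element that is not a vertex of `G` would be a convex combination of other basis
  -- elements, against real linear independence.
  refine hvG.antisymm fun b hb => ?_
  by_contra hbG
  have hbc : b ∈ convexHull ℝ (vertices G) := by
    rw [hG.convexHull_vertices hS]
    exact ⟨subset_convexHull ℝ S hb.1, hb.2⟩
  have hsub : vertices G ⊆ {s ∈ S | l' s = 1} \ {b} := fun x hx =>
    ⟨hvG hx, fun h => hbG (h ▸ hx)⟩
  have := convexHull_min Submodule.subset_span (Submodule.span ℝ _).convex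
    (convexHull_mono hsub hbc)
  exact (linearIndepOn_iff_notMem_span.1 hB.linearIndepOn_real) b hb (by simpa using this)

/-! ### Coordinates on the product and free sums. -/

/-- The inclusion `ℝ^a → ℝ^(a+b)` as the first coordinates. -/
def inlMap (a b : ℕ) : (Fin a → ℝ) →ₗ[ℝ] (Fin (a + b) → ℝ) where
  toFun v := Fin.append v 0
  map_add' v w := by
    funext i
    refine Fin.addCases (fun i => ?_) (fun i => ?_) i <;> simp
  map_smul' c v := by
    funext i
    refine Fin.addCases (fun i => ?_) (fun i => ?_) i <;> simp

/-- The inclusion `ℝ^b → ℝ^(a+b)` as the last coordinates. -/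
def inrMap (a b : ℕ) : (Fin b → ℝ) →ₗ[ℝ] (Fin (a + b) → ℝ) where
  toFun v := Fin.append 0 v
  map_add' v w := by
    funext i
    refine Fin.addCases (fun i => ?_) (fun i => ?_) i <;> simp
  map_smul' c v := by
    funext i
    refine Fin.addCases (fun i => ?_) (fun i => ?_) i <;> simp

/-- The projection of `ℝ^(a+b)` to the first coordinates. -/
def fstMap (a b : ℕ) : (Fin (a + b) → ℝ) →L[ℝ] (Fin a → ℝ) :=
  ContinuousLinearMap.pi fun i => ContinuousLinearMap.proj (Fin.castAdd b i)

/-- The projection of `ℝ^(a+b)` to the last coordinates. -/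
def sndMap (a b : ℕ) : (Fin (a + b) → ℝ) →L[ℝ] (Fin b → ℝ) :=
  ContinuousLinearMap.pi fun i => ContinuousLinearMap.proj (Fin.natAdd a i)

section
variable {a b : ℕ}

@[simp] theorem fstMap_inlMap (x : Fin a → ℝ) : fstMap a b (inlMap a b x) = x := by
  funext i; simp [fstMap, inlMap]

@[simp] theorem sndMap_inlMap (x : Fin a → ℝ) : sndMap a b (inlMap a b x) = 0 := by
  funext i; simp [sndMap, inlMap]

@[simp] theorem fstMap_inrMap (x : Fin b → ℝ) : fstMap a b (inrMap a b x) = 0 := by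
  funext i; simp [fstMap, inrMap]

@[simp] theorem sndMap_inrMap (x : Fin b → ℝ) : sndMap a b (inrMap a b x) = x := by
  funext i; simp [sndMap, inrMap]

theorem inlMap_fstMap_add_inrMap_sndMap (z : Fin (a + b) → ℝ) :
    inlMap a b (fstMap a b z) + inrMap a b (sndMap a b z) = z := by
  funext i
  refine Fin.addCases (fun i => ?_) (fun i => ?_) i <;> simp [fstMap, sndMap, inlMap, inrMap]

theorem mem_intLattice_add_iff {z : Fin (a + b) → ℝ} :
    z ∈ intLattice (a + b) ↔ fstMap a b z ∈ intLattice a ∧ sndMap a b z ∈ intLattice b := by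
  simp only [mem_intLattice_iff]
  refine ⟨fun h => ⟨fun i => h _, fun i => h _⟩, fun h i => ?_⟩
  exact Fin.addCases (fun i => h.1 i) (fun i => h.2 i) i

/-- A lattice basis of `ℤ^a` and a set of lattice points that projects to a lattice basis of `ℤ^b`
form a lattice basis of `ℤ^(a+b)`. -/
theorem IsLatticeBasis.image_inlMap_union {B : Set (Fin a → ℝ)} (hB : IsLatticeBasis B)
    {C : Set (Fin (a + b) → ℝ)} (hCL : C ⊆ intLattice (a + b))
    (hC : LinearIndepOn ℤ (sndMap a b) C)
    (hCs : Submodule.span ℤ (sndMap a b '' C) = intLattice b) :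
    IsLatticeBasis (inlMap a b '' B ∪ C) := by
  let i : (Fin a → ℝ) →ₗ[ℤ] (Fin (a + b) → ℝ) := (inlMap a b).restrictScalars ℤ
  let p : (Fin (a + b) → ℝ) →ₗ[ℤ] (Fin b → ℝ) := (sndMap a b).toLinearMap.restrictScalars ℤ
  have hi : Function.Injective i := Function.LeftInverse.injective fstMap_inlMap
  have hspan : Submodule.span ℤ (inlMap a b '' B) = (intLattice a).map i := by
    rw [← hB.2, Submodule.map_span]
    rfl
  constructor
  · refine LinearIndepOn.id_union ?_ ?_ ?_
    · have : LinearIndepOn ℤ (i ∘ id) B := hB.1.map' i (LinearMap.ker_eq_bot.2 hi)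
      exact this.id_image
    · exact LinearIndepOn.of_comp p hC
    -- The projection is injective on the span of `C` and kills the first block, so the two spans
    -- are disjoint.
    · have h : LinearIndependent ℤ (p ∘ fun x : C => (x : Fin (a + b) → ℝ)) := hC
      have hd := Submodule.range_ker_disjoint h
      rw [Subtype.range_coe] at hd
      refine hd.symm.mono_left ?_
      rw [hspan, Submodule.map_le_iff_le_comap]
      exact fun x _ => sndMap_inlMap x
  · refine le_antisymm (Submodule.span_le.2 (Set.union_subset ?_ hCL)) fun z hz => ?_
    · rintro _ ⟨x, hx, rfl⟩
      refine mem_intLattice_add_iff.2 ⟨?_, by simp⟩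
      rw [fstMap_inlMap, ← hB.2]
      exact Submodule.subset_span hx
    · have hz2 : sndMap a b z ∈ (Submodule.span ℤ C).map p := by
        rw [Submodule.map_span]
        exact hCs.symm ▸ (mem_intLattice_add_iff.1 hz).2
      obtain ⟨t, ht, htz⟩ := hz2
      have hsub : z - t ∈ Submodule.span ℤ (inlMap a b '' B) := by
        have htL : z - t ∈ intLattice (a + b) :=
          sub_mem hz (Submodule.span_le.2 hCL ht)
        rw [hspan]
        refine ⟨fstMap a b (z - t), (mem_intLattice_add_iff.1 htL).1, ?_⟩
        have h0 : sndMap a b (z - t) = 0 := by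
          rw [map_sub, ← htz]
          exact sub_self _
        have := inlMap_fstMap_add_inrMap_sndMap (z - t)
        rwa [h0, map_zero, add_zero] at this
      rw [← sub_add_cancel z t]
      exact add_mem (Submodule.span_mono Set.subset_union_left hsub)
        (Submodule.span_mono Set.subset_union_right ht)

theorem freeSum_eq (P : Set (Fin a → ℝ)) (Q : Set (Fin b → ℝ)) :
    freeSum P Q = convexHull ℝ (inlMap a b '' P ∪ inrMap a b '' Q) := rfl

theorem convexHull_image_union_image {S : Set (Fin a → ℝ)} {T : Set (Fin b → ℝ)} :
    freeSum (convexHull ℝ S) (convexHull ℝ T) =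
      convexHull ℝ (inlMap a b '' S ∪ inrMap a b '' T) := by
  rw [freeSum_eq, LinearMap.image_convexHull, LinearMap.image_convexHull,
    convexHull_convexHull_union_left, convexHull_convexHull_union_right]

/-- A point is the midpoint of its doubled projections, which lie in `P` and `Q` when the point is
near the origin. -/
theorem zero_mem_interior_freeSum {P : Set (Fin a → ℝ)} {Q : Set (Fin b → ℝ)}
    (hP : (0 : Fin a → ℝ) ∈ interior P) (hQ : (0 : Fin b → ℝ) ∈ interior Q) :
    (0 : Fin (a + b) → ℝ) ∈ interior (freeSum P Q) := by
  rw [mem_interior_iff_mem_nhds] at *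
  have h1 : Filter.Tendsto (fun z => (2 : ℝ) • fstMap a b z) (nhds 0) (nhds 0) :=
    (((fstMap a b).continuous.const_smul (2 : ℝ)).tendsto' 0 0 (by simp))
  have h2 : Filter.Tendsto (fun z => (2 : ℝ) • sndMap a b z) (nhds 0) (nhds 0) :=
    (((sndMap a b).continuous.const_smul (2 : ℝ)).tendsto' 0 0 (by simp))
  filter_upwards [h1 hP, h2 hQ] with z hz1 hz2
  have e1 : inlMap a b ((2 : ℝ) • fstMap a b z) ∈ freeSum P Q :=
    subset_convexHull ℝ _ (Or.inl ⟨_, hz1, rfl⟩)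
  have e2 : inrMap a b ((2 : ℝ) • sndMap a b z) ∈ freeSum P Q :=
    subset_convexHull ℝ _ (Or.inr ⟨_, hz2, rfl⟩)
  have := convex_convexHull ℝ _ e1 e2 (a := 1 / 2) (b := 1 / 2) (by norm_num) (by norm_num)
    (by norm_num)
  rw [map_smul, map_smul, smul_smul, smul_smul] at this
  norm_num at this
  rwa [inlMap_fstMap_add_inrMap_sndMap] at this

theorem IsSmoothFano.freeSum {P : Set (Fin a → ℝ)} {Q : Set (Fin b → ℝ)}
    (hP : IsSmoothFano P) (hQ : IsSmoothFano Q) : IsSmoothFano (freeSum P Q) := by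
  have h0 := zero_mem_interior_freeSum hP.zero_mem_interior hQ.zero_mem_interior
  rw [← hP.convexHull_vertices, ← hQ.convexHull_vertices, convexHull_image_union_image] at h0 ⊢
  refine isSmoothFano_convexHull ((hP.vertices_finite.image _).union
    (hQ.vertices_finite.image _)) ?_ h0 ?_
  · rintro _ (⟨x, hx, rfl⟩ | ⟨x, hx, rfl⟩)
    · exact mem_intLattice_add_iff.2 (by simpa using hP.vertices_subset hx)
    · exact mem_intLattice_add_iff.2 (by simpa using hQ.vertices_subset hx)
  intro l hl
  obtain ⟨l₁, h₁, hl₁, hB₁⟩ := hP.hasUnimodularFaces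
    (l.comp (inlMap a b).toContinuousLinearMap) fun s hs => hl _ (Or.inl ⟨s, hs, rfl⟩)
  obtain ⟨l₂, h₂, hl₂, hB₂⟩ := hQ.hasUnimodularFaces
    (l.comp (inrMap a b).toContinuousLinearMap) fun s hs => hl _ (Or.inr ⟨s, hs, rfl⟩)
  refine ⟨l₁.comp (fstMap a b) + l₂.comp (sndMap a b), ?_, ?_, ?_⟩
  · rintro _ (⟨x, hx, rfl⟩ | ⟨x, hx, rfl⟩)
    · simpa using h₁ x hx
    · simpa using h₂ x hx
  · rintro _ (⟨x, hx, rfl⟩ | ⟨x, hx, rfl⟩) h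
    · simpa using hl₁ x hx h
    · simpa using hl₂ x hx h
  · have hC : LinearIndepOn ℤ (sndMap a b) (inrMap a b '' {s ∈ vertices Q | l₂ s = 1}) := by
      refine LinearIndepOn.image_of_comp (inrMap a b) (sndMap a b) ?_
      have : ⇑(sndMap a b) ∘ ⇑(inrMap a b) = id := funext sndMap_inrMap
      exact this ▸ hB₂.1
    convert hB₁.image_inlMap_union ?_ hC ?_ using 1
    · ext z
      constructor
      · rintro ⟨⟨x, hx, rfl⟩ | ⟨x, hx, rfl⟩, h⟩
        · exact Or.inl ⟨x, ⟨hx, by simpa using h⟩, rfl⟩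
        · exact Or.inr ⟨x, ⟨hx, by simpa using h⟩, rfl⟩
      · rintro (⟨x, hx, rfl⟩ | ⟨x, hx, rfl⟩)
        · exact ⟨Or.inl ⟨x, hx.1, rfl⟩, by simpa using hx.2⟩
        · exact ⟨Or.inr ⟨x, hx.1, rfl⟩, by simpa using hx.2⟩
    · rintro _ ⟨x, hx, rfl⟩
      exact mem_intLattice_add_iff.2 (by simpa using hQ.vertices_subset hx.1)
    · rw [Set.image_image]
      simpa using hB₂.2

end

/-! ### Bipyramids and their apices. -/

section
variable {d : ℕ}

@[simp] theorem fstMap_pt (x : Fin d → ℝ) (h : ℝ) : fstMap d 1 (pt x h) = x := by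
  funext i; simp [fstMap, pt]

@[simp] theorem sndMap_pt (x : Fin d → ℝ) (h : ℝ) : sndMap d 1 (pt x h) = fun _ => h := by
  funext i; simp [sndMap, pt]

theorem pt_fstMap_sndMap (z : Fin (d + 1) → ℝ) : pt (fstMap d 1 z) (sndMap d 1 z 0) = z := by
  funext i
  refine Fin.addCases (fun i => ?_) (fun i => ?_) i
  · simp [pt, fstMap]
  · simp [pt, sndMap, Subsingleton.elim i 0]

theorem inlMap_eq_pt (x : Fin d → ℝ) : inlMap d 1 x = pt x 0 := rfl

theorem smul_pt_add_smul_pt (α β h k : ℝ) (x y : Fin d → ℝ) :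
    α • pt x h + β • pt y k = pt (α • x + β • y) (α * h + β * k) := by
  funext i
  refine Fin.addCases (fun i => ?_) (fun i => ?_) i <;> simp [pt]

theorem mem_intLattice_one_of_int (n : ℤ) : (fun _ => (n : ℝ)) ∈ intLattice 1 :=
  mem_intLattice_iff.2 fun _ => ⟨n, rfl⟩

/-- The linear functional `(x, h) ↦ l x + c h`. -/
def liftFunctional (l : (Fin d → ℝ) →L[ℝ] ℝ) (c : ℝ) : (Fin (d + 1) → ℝ) →L[ℝ] ℝ :=
  l.comp (fstMap d 1) + c • (ContinuousLinearMap.proj 0).comp (sndMap d 1)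

@[simp] theorem liftFunctional_pt (l : (Fin d → ℝ) →L[ℝ] ℝ) (c : ℝ) (x : Fin d → ℝ) (h : ℝ) :
    liftFunctional l c (pt x h) = l x + c * h := by
  simp [liftFunctional]

theorem eq_liftFunctional (l : (Fin (d + 1) → ℝ) →L[ℝ] ℝ) :
    l = liftFunctional (l.comp (inlMap d 1).toContinuousLinearMap) (l (pt 0 1)) := by
  ext1 z
  rw [← pt_fstMap_sndMap z, liftFunctional_pt]
  have := smul_pt_add_smul_pt 1 (sndMap d 1 z 0) 0 1 (fstMap d 1 z) 0
  simp only [one_smul, smul_zero, add_zero, mul_one, zero_add, mul_zero] at this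
  rw [← this, map_add, map_smul]
  simp [inlMap_eq_pt, mul_comm]

theorem IsLatticeBasis.image_pt_zero_union {B : Set (Fin d → ℝ)} (hB : IsLatticeBasis B)
    {x : Fin d → ℝ} (hx : x ∈ intLattice d) {ε : ℤ} (hε : IsUnit ε) :
    IsLatticeBasis ((fun z => pt z 0) '' B ∪ {pt x ε}) := by
  refine hB.image_inlMap_union (b := 1) ?_ ?_ ?_
  · rintro _ rfl
    exact mem_intLattice_add_iff.2 (by simpa using ⟨hx, mem_intLattice_one_of_int ε⟩)
  · rw [linearIndepOn_singleton_iff, sndMap_pt]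
    intro h
    have := congrFun h 0
    exact hε.ne_zero (by simpa using this)
  · rw [Set.image_singleton, sndMap_pt]
    refine le_antisymm (Submodule.span_le.2 ?_) fun z hz => ?_
    · rintro _ rfl
      exact mem_intLattice_one_of_int ε
    · obtain ⟨n, hn⟩ := mem_intLattice_iff.1 hz 0
      refine Submodule.mem_span_singleton.2 ⟨n * ε, ?_⟩
      funext i
      have hsq : (ε : ℝ) * ε = 1 := by exact_mod_cast Int.isUnit_mul_self hε
      rw [Subsingleton.elim i 0, hn]
      simp [mul_assoc, hsq]

theorem zero_mem_interior_convexHull_apices {P : Set (Fin d → ℝ)}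
    (hP : (0 : Fin d → ℝ) ∈ interior P) (x y : Fin d → ℝ) :
    (0 : Fin (d + 1) → ℝ) ∈
      interior (convexHull ℝ ((fun z => pt z 0) '' P ∪ {pt x 1, pt y (-1)})) := by
  rw [mem_interior_iff_mem_nhds] at *
  have key : ∀ v : Fin d → ℝ, ∀ ε : ℝ, ε * ε = 1 → pt v ε ∈ ({pt x 1, pt y (-1)} : Set _) →
      ∀ᶠ z in nhds (0 : Fin (d + 1) → ℝ), 0 ≤ ε * sndMap d 1 z 0 →
        z ∈ convexHull ℝ ((fun z => pt z 0) '' P ∪ {pt x 1, pt y (-1)}) := by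
    intro v ε hε hv
    have ht : Continuous fun z : Fin (d + 1) → ℝ => ε * sndMap d 1 z 0 :=
      continuous_const.mul ((continuous_apply 0).comp (sndMap d 1).continuous)
    -- With `t = ε * height`, this is the base point `p` solving `z = (1 - t) p + t (v, ε)`; it
    -- tends to `0` with `z`.
    have h1 : Filter.Tendsto (fun z => (1 - ε * sndMap d 1 z 0)⁻¹ •
        (fstMap d 1 z - (ε * sndMap d 1 z 0) • v)) (nhds 0) (nhds 0) := by
      have hc : ContinuousAt (fun z => (1 - ε * sndMap d 1 z 0)⁻¹ •
          (fstMap d 1 z - (ε * sndMap d 1 z 0) • v)) (0 : Fin (d + 1) → ℝ) :=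
        ((continuous_const.sub ht).continuousAt.inv₀ (by simp)).smul
          ((fstMap d 1).continuous.sub (ht.smul continuous_const)).continuousAt
      simpa [ContinuousAt] using hc
    have h2 : ∀ᶠ z in nhds (0 : Fin (d + 1) → ℝ), ε * sndMap d 1 z 0 < 1 :=
      ht.continuousAt.eventually_lt continuousAt_const (by simp)
    filter_upwards [h1 hP, h2] with z hz hlt hnn
    set t := ε * sndMap d 1 z 0 with htdef
    have e1 := subset_convexHull ℝ ((fun z => pt z 0) '' P ∪ {pt x 1, pt y (-1)})
      (Or.inl ⟨_, hz, rfl⟩)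
    have e2 := subset_convexHull ℝ ((fun z => pt z 0) '' P ∪ {pt x 1, pt y (-1)}) (Or.inr hv)
    have := convex_convexHull ℝ _ e1 e2 (sub_nonneg.2 hlt.le) hnn (by ring)
    rw [smul_pt_add_smul_pt, smul_smul, mul_inv_cancel₀ (sub_pos.2 hlt).ne', one_smul,
      sub_add_cancel, mul_zero, zero_add] at this
    have hs : t * ε = sndMap d 1 z 0 := by rw [htdef, mul_right_comm, hε, one_mul]
    rwa [hs, pt_fstMap_sndMap] at this
  filter_upwards [key x 1 (by norm_num) (by simp), key y (-1) (by norm_num) (by simp)]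
    with z h1 h2
  rcases le_total 0 (sndMap d 1 z 0) with h | h
  · exact h1 (by simpa using h)
  · exact h2 (by simpa using h)

theorem lt_one_of_mem_interior {P : Set (Fin d → ℝ)} {l : (Fin d → ℝ) →L[ℝ] ℝ}
    (hl : ∀ x ∈ P, l x ≤ 1) {m : Fin d → ℝ} (hm : m ∈ interior P) :
    l m < 1 := by
  refine lt_of_le_of_ne (hl m (interior_subset hm)) fun h => ?_
  have := ContinuousLinearMap.eq_zero_of_le_of_mem_interior hm (h ▸ hl)
  simp [this] at h

/-- The convex hull of a smooth Fano polytope and two lattice points at heights `1` and `-1` is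
smooth Fano if the segment between the two points meets the interior of the polytope. -/
theorem IsSmoothFano.convexHull_apices {P : Set (Fin d → ℝ)} (hP : IsSmoothFano P)
    {x y : Fin d → ℝ} (hx : x ∈ intLattice d) (hy : y ∈ intLattice d)
    (hm : (1 / 2 : ℝ) • (x + y) ∈ interior P) :
    IsSmoothFano (convexHull ℝ ((fun z => pt z 0) '' P ∪ {pt x 1, pt y (-1)})) := by
  have h0 := zero_mem_interior_convexHull_apices hP.zero_mem_interior x y
  have hconv : convexHull ℝ ((fun z => pt z 0) '' P ∪ {pt x 1, pt y (-1)}) =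
      convexHull ℝ ((fun z => pt z 0) '' vertices P ∪ {pt x 1, pt y (-1)}) := by
    conv_lhs => rw [← hP.convexHull_vertices]
    have := LinearMap.image_convexHull (inlMap d 1) (vertices P)
    exact (congrArg (fun A => convexHull ℝ (A ∪ {pt x 1, pt y (-1)})) this).trans
      (convexHull_convexHull_union_left _ _)
  have hmid : ∀ l : (Fin d → ℝ) →L[ℝ] ℝ, (∀ z ∈ vertices P, l z ≤ 1) → l x + l y < 2 := by
    intro l hl
    have := lt_one_of_mem_interior (fun z hz => le_of_mem_convexHull hl
      (hP.convexHull_vertices.symm ▸ hz)) hm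
    rw [map_smul, map_add, smul_eq_mul] at this
    linarith
  rw [hconv] at h0 ⊢
  refine isSmoothFano_convexHull ((hP.vertices_finite.image _).union (Set.toFinite _)) ?_ h0 ?_
  · rintro _ (⟨z, hz, rfl⟩ | rfl | rfl)
    · exact mem_intLattice_add_iff.2
        (by simpa using ⟨hP.vertices_subset hz, by simpa using mem_intLattice_one_of_int 0⟩)
    · exact mem_intLattice_add_iff.2
        (by simpa using ⟨hx, by simpa using mem_intLattice_one_of_int 1⟩)
    · exact mem_intLattice_add_iff.2
        (by simpa using ⟨hy, by simpa using mem_intLattice_one_of_int (-1)⟩)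
  intro L hL
  rw [eq_liftFunctional L] at hL ⊢
  set l := L.comp (inlMap d 1).toContinuousLinearMap
  set c := L (pt 0 1)
  have hlP : ∀ z ∈ vertices P, l z ≤ 1 := fun z hz => by
    simpa using hL _ (Or.inl ⟨z, hz, rfl⟩)
  have hLx : l x + c ≤ 1 := by simpa using hL (pt x 1) (Or.inr (Or.inl rfl))
  have hLy : l y + -c ≤ 1 := by simpa using hL (pt y (-1)) (Or.inr (Or.inr rfl))
  have hlt := hmid l hlP
  obtain ⟨l', hl', hll', hB⟩ := hP.hasUnimodularFaces l hlP
  have hlt' := hmid l' hl'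
  -- At most one apex is tight for `L`, because its values at the two sum to `l x + l y < 2`. The
  -- non-tight one is dropped.
  rcases lt_or_ge (l y + -c) 1 with hy1 | hy1
  -- This slope gives the value `1` at the upper apex and `l' x + l' y - 1 < 1` at the lower one.
  · refine ⟨liftFunctional l' (1 - l' x), ?_, ?_, ?_⟩
    · rintro _ (⟨z, hz, rfl⟩ | rfl | rfl)
      · simpa using hl' z hz
      · simp
      · rw [liftFunctional_pt]; linarith
    · rintro _ (⟨z, hz, rfl⟩ | rfl | rfl) h
      · simpa using hll' z hz (by simpa using h)
      · simp
      · rw [liftFunctional_pt] at h; linarith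
    · have := hB.image_pt_zero_union hx (ε := 1) isUnit_one
      rw [Int.cast_one] at this
      convert this using 1
      ext z
      constructor
      · rintro ⟨⟨z, hz, rfl⟩ | rfl | rfl, h⟩
        · exact Or.inl ⟨z, ⟨hz, by simpa using h⟩, rfl⟩
        · exact Or.inr rfl
        · rw [liftFunctional_pt] at h; linarith
      · rintro (⟨z, hz, rfl⟩ | rfl)
        · exact ⟨Or.inl ⟨z, hz.1, rfl⟩, by simpa using hz.2⟩
        · exact ⟨Or.inr (Or.inl rfl), by simp⟩
  · refine ⟨liftFunctional l' (l' y - 1), ?_, ?_, ?_⟩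
    · rintro _ (⟨z, hz, rfl⟩ | rfl | rfl)
      · simpa using hl' z hz
      · rw [liftFunctional_pt]; linarith
      · simp
    · rintro _ (⟨z, hz, rfl⟩ | rfl | rfl) h
      · simpa using hll' z hz (by simpa using h)
      · rw [liftFunctional_pt] at h; linarith
      · simp
    · have := hB.image_pt_zero_union hy (ε := -1) isUnit_one.neg
      rw [Int.cast_neg, Int.cast_one] at this
      convert this using 1
      ext z
      constructor
      · rintro ⟨⟨z, hz, rfl⟩ | rfl | rfl, h⟩
        · exact Or.inl ⟨z, ⟨hz, by simpa using h⟩, rfl⟩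
        · rw [liftFunctional_pt] at h; linarith
        · exact Or.inr rfl
      · rintro (⟨z, hz, rfl⟩ | rfl)
        · exact ⟨Or.inl ⟨z, hz.1, rfl⟩, by simpa using hz.2⟩
        · exact ⟨Or.inr (Or.inr rfl), by simp⟩

theorem smoothBipyramid_eq (P : Set (Fin d → ℝ)) :
    smoothBipyramid P = convexHull ℝ ((fun z => pt z 0) '' P ∪ {pt 0 1, pt 0 (-1)}) := by
  refine subset_antisymm (convexHull_min ?_ (convex_convexHull ℝ _)) (convexHull_mono ?_)
  · rintro _ (⟨z, hz, rfl⟩ | ⟨w, hw, rfl⟩)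
    · exact subset_convexHull ℝ _ (Or.inl ⟨z, hz, rfl⟩)
    · have h1 : -1 ≤ w 0 := hw.1 0
      have h2 : w 0 ≤ 1 := hw.2 0
      have e1 := subset_convexHull ℝ ((fun z => pt z 0) '' P ∪ {pt 0 1, pt 0 (-1)})
        (Or.inr (Or.inl rfl))
      have e2 := subset_convexHull ℝ ((fun z => pt z 0) '' P ∪ {pt 0 1, pt 0 (-1)})
        (Or.inr (Or.inr rfl))
      have := convex_convexHull ℝ _ e1 e2 (a := (1 + w 0) / 2) (b := (1 - w 0) / 2)
        (by linarith) (by linarith) (by ring)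
      rw [smul_pt_add_smul_pt] at this
      convert this using 1
      have hw0 : w = fun _ => w 0 := funext fun i => by rw [Subsingleton.elim i 0]
      simp only [smul_zero, add_zero, pt]
      rw [hw0]
      congr 1
      funext _
      ring
  · rintro _ (⟨z, hz, rfl⟩ | rfl | rfl)
    · exact Or.inl ⟨z, hz, rfl⟩
    · exact Or.inr ⟨fun _ => 1, ⟨fun _ => by norm_num, fun _ => le_rfl⟩, rfl⟩
    · exact Or.inr ⟨fun _ => -1, ⟨fun _ => le_rfl, fun _ => by norm_num⟩, rfl⟩

theorem IsSmoothFano.smoothBipyramid {P : Set (Fin d → ℝ)} (hP : IsSmoothFano P) :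
    IsSmoothFano (smoothBipyramid P) := by
  rw [smoothBipyramid_eq]
  exact hP.convexHull_apices (zero_mem _) (zero_mem _) (by simpa using hP.zero_mem_interior)

theorem IsSmoothFano.smoothSkewBipyramid {P : Set (Fin d → ℝ)} (hP : IsSmoothFano P)
    {v : Fin d → ℝ} (hv : v ∈ vertices P) : IsSmoothFano (smoothSkewBipyramid P v) := by
  have := hP.convexHull_apices (hP.vertices_subset hv) (zero_mem _) (by
    rw [add_zero]
    have := hP.convex.combo_interior_self_mem_interior hP.zero_mem_interior hv.1
      (a := 1 / 2) (b := 1 / 2) (by norm_num) (by norm_num) (by norm_num)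
    simpa using this)
  rwa [Set.pair_comm] at this

/-- No proper face of a skew bipyramid contains both apices. -/
theorem IsSkewBipyramid.eq_of_isExposed {P : Set (Fin d → ℝ)} {R : Set (Fin (d + 1) → ℝ)}
    {u w : Fin (d + 1) → ℝ} (hR : IsSkewBipyramid P R u w) (hP : (0 : Fin d → ℝ) ∈ interior P)
    {G : Set (Fin (d + 1) → ℝ)} (hG : IsExposed ℝ R G) (hu : u ∈ G) (hw : w ∈ G) : G = R := by
  obtain ⟨-, s, t, hs, ht, φ, ⟨T, hT, hφT⟩, B, hB, hφB⟩ := hR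
  let G' : FaceLattice R := ⟨G, hG⟩
  have hTG : T ≤ φ.symm G' := by
    rw [OrderIso.le_symm_apply]
    change (φ T).1 ⊆ G
    rw [hφT]
    simpa using hu
  have hBG : B ≤ φ.symm G' := by
    rw [OrderIso.le_symm_apply]
    change (φ B).1 ⊆ G
    rw [hφB]
    simpa using hw
  have hTm : pt 0 t ∈ (φ.symm G').1 := hTG (by rw [hT]; rfl)
  have hBm : pt 0 (-s) ∈ (φ.symm G').1 := hBG (by rw [hB]; rfl)
  have hseg : (0 : Fin 1 → ℝ) ∈ interior (seg (-s) t) := by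
    rw [mem_interior_iff_mem_nhds, seg, ← Set.pi_univ_Icc]
    refine set_pi_mem_nhds Set.finite_univ fun i _ => Icc_mem_nhds ?_ ht
    simpa using hs
  have h0 := zero_mem_interior_freeSum hP hseg
  have h0G : (0 : Fin (d + 1) → ℝ) ∈ (φ.symm G').1 := by
    have hst : 0 < s + t := by positivity
    -- These weights express the origin by the two ends of the segment; a face through this interior
    -- point is the whole bipyramid.
    have := (φ.symm G').2.convex (convex_convexHull ℝ _) hTm hBm (a := s / (s + t))
      (b := t / (s + t)) (by positivity) (by positivity) (by field_simp)
    rw [smul_pt_add_smul_pt] at this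
    have e : s / (s + t) * t + t / (s + t) * -s = 0 := by ring
    rw [e, smul_zero, smul_zero, add_zero, ← inlMap_eq_pt, map_zero] at this
    exact this
  have htop : (φ.symm G').1 = freeSum P (seg (-s) t) :=
    (φ.symm G').2.eq_of_mem_interior h0G h0
  have hle : (⟨R, IsExposed.refl R⟩ : FaceLattice R) ≤ G' := by
    rw [← φ.symm.le_iff_le]
    change (φ.symm ⟨R, IsExposed.refl R⟩).1 ⊆ (φ.symm G').1
    rw [htop]
    exact (φ.symm ⟨R, IsExposed.refl R⟩).2.subset
  exact hG.subset.antisymm hle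

/-- The convex hull of a smooth Fano polytope and two lattice points at heights `1` and `-1` is
smooth Fano if no proper face contains both points. -/
theorem IsSmoothFano.of_apices_of_face {P : Set (Fin d → ℝ)}
    (hP : IsSmoothFano P) {R : Set (Fin (d + 1) → ℝ)} {x y : Fin d → ℝ}
    (hR : R = convexHull ℝ ((fun z => pt z 0) '' P ∪ {pt x 1, pt y (-1)}))
    (hface : ∀ G, IsExposed ℝ R G → pt x 1 ∈ G → pt y (-1) ∈ G → G = R)
    (hx : x ∈ intLattice d) (hy : y ∈ intLattice d) : IsSmoothFano R := by
  have h0P := hP.zero_mem_interior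
  suffices hm : (1 / 2 : ℝ) • (x + y) ∈ interior P from
    hR ▸ hP.convexHull_apices hx hy hm
  by_contra hm
  obtain ⟨f, hf⟩ := geometric_hahn_banach_open_point hP.convex.interior isOpen_interior hm
  have hpos : 0 < f ((1 / 2 : ℝ) • (x + y)) := by simpa using hf 0 h0P
  set k := f ((1 / 2 : ℝ) • (x + y)) with hk
  -- Separation bounds `f` on the interior only; `P` lies in the closure of its interior.
  have hfP : ∀ z ∈ P, f z ≤ k := by
    intro z hz
    have hsub : closure (interior P) ⊆ {z | f z ≤ k} :=
      closure_minimal (fun z hz => (hf z hz).le) (isClosed_le f.continuous continuous_const)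
    apply hsub
    rw [hP.convex.closure_interior_eq_closure_of_nonempty_interior ⟨0, h0P⟩]
    exact subset_closure hz
  have hsum : f x + f y = 2 * k := by
    rw [hk, map_smul, map_add, smul_eq_mul]
    ring
  -- The slope makes `L` equal to `k` at both apices, since `f x + f y = 2 * k`; then `k⁻¹ • L = 1`
  -- is a proper face containing both.
  let L := liftFunctional f (k - f x)
  have hLR : ∀ z ∈ R, (k⁻¹ • L) z ≤ 1 := by
    rw [hR]
    intro z hz
    refine le_of_mem_convexHull ?_ hz
    intro z hz
    rw [smul_apply, smul_eq_mul, inv_mul_le_one₀ hpos]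
    rcases hz with ⟨z, hz, rfl⟩ | rfl | rfl
    · simpa [L] using hfP z hz
    · simp [L]
    · rw [liftFunctional_pt]; linarith
  have hLu : (k⁻¹ • L) (pt x 1) = 1 := by
    simp [L, hpos.ne']
  have hLw : (k⁻¹ • L) (pt y (-1)) = 1 := by
    rw [smul_apply, smul_eq_mul, inv_mul_eq_one₀ hpos.ne', liftFunctional_pt]
    linarith
  have huR : pt x 1 ∈ R := hR ▸ subset_convexHull ℝ _ (Or.inr (Or.inl rfl))
  have hwR : pt y (-1) ∈ R := hR ▸ subset_convexHull ℝ _ (Or.inr (Or.inr rfl))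
  have h0R : (0 : Fin (d + 1) → ℝ) ∈ R :=
    hR ▸ subset_convexHull ℝ _ (Or.inl ⟨0, interior_subset h0P, map_zero (inlMap d 1)⟩)
  have := hface _ (isExposed_setOf_eq_one hLR) ⟨huR, hLu⟩ ⟨hwR, hLw⟩
  rw [← this] at h0R
  simpa using h0R.2

theorem IsSmoothFano.of_isSmoothGeneralizedSkewBipyramid {P : Set (Fin d → ℝ)}
    (hP : IsSmoothFano P) {R : Set (Fin (d + 1) → ℝ)}
    (hR : IsSmoothGeneralizedSkewBipyramid P R) : IsSmoothFano R := by
  obtain ⟨u, w, hs, hu, hw, hdu, hdw⟩ := hR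
  have h0P := hP.zero_mem_interior
  have hface : ∀ G, IsExposed ℝ R G → u ∈ G → w ∈ G → G = R :=
    fun G hG => hs.eq_of_isExposed h0P hG
  have hRe := hs.1
  have hu' := (mem_intLattice_add_iff.1 hu).1
  have hw' := (mem_intLattice_add_iff.1 hw).1
  have hcu : sndMap d 1 u 0 = 1 ∨ sndMap d 1 u 0 = -1 := eq_or_eq_neg_of_abs_eq hdu
  have hcw : sndMap d 1 w 0 = 1 ∨ sndMap d 1 w 0 = -1 := eq_or_eq_neg_of_abs_eq hdw
  rw [← pt_fstMap_sndMap u, ← pt_fstMap_sndMap w] at hRe hface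
  generalize fstMap d 1 u = x at *
  generalize fstMap d 1 w = y at *
  generalize sndMap d 1 u 0 = α at *
  generalize sndMap d 1 w 0 = β at *
  have hαβ : α ≠ β := by
    rintro rfl
    have hα : α * α = 1 := by rcases hcu with h | h <;> rw [h] <;> norm_num
    -- If the apices share the height `α = ±1`, the functional `α * height` is `1` at both and `0`
    -- on the base, so it exposes a forbidden face.
    have hL : ∀ z ∈ R, liftFunctional 0 α z ≤ 1 := by
      rw [hRe]
      intro z hz
      refine le_of_mem_convexHull ?_ hz
      rintro _ (⟨z, hz, rfl⟩ | rfl | rfl) <;> simp [hα]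
    have huR : pt x α ∈ R := hRe ▸ subset_convexHull ℝ _ (Or.inr (Or.inl rfl))
    have hwR : pt y α ∈ R := hRe ▸ subset_convexHull ℝ _ (Or.inr (Or.inr rfl))
    have h0R : (0 : Fin (d + 1) → ℝ) ∈ R :=
      hRe ▸ subset_convexHull ℝ _ (Or.inl ⟨0, interior_subset h0P, map_zero (inlMap d 1)⟩)
    have := hface _ (isExposed_setOf_eq_one hL) ⟨huR, by simp [hα]⟩ ⟨hwR, by simp [hα]⟩
    rw [← this] at h0R
    simpa using h0R.2
  rcases hcu with rfl | rfl <;> rcases hcw with rfl | rfl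
  · exact absurd rfl hαβ
  · exact hP.of_apices_of_face hRe hface hu' hw'
  · rw [Set.pair_comm] at hRe
    exact hP.of_apices_of_face hRe (fun G hG h1 h2 => hface G hG h2 h1) hw' hu'
  · exact absurd rfl hαβ

end

theorem mainTheorem1 {a b : ℕ} (P : Set (Fin a → ℝ)) (Q : Set (Fin b → ℝ))
    (hP : IsSmoothFano P) (hQ : IsSmoothFano Q) :
    IsSmoothFano (freeSum P Q) ∧
    IsSmoothFano (smoothBipyramid P) ∧
    (∀ v ∈ vertices P, IsSmoothFano (smoothSkewBipyramid P v)) ∧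
    (∀ R : Set (Fin (a + 1) → ℝ), IsSmoothGeneralizedSkewBipyramid P R → IsSmoothFano R) :=
  ⟨hP.freeSum hQ, hP.smoothBipyramid, fun _ hv => hP.smoothSkewBipyramid hv,
    fun _ hR => hP.of_isSmoothGeneralizedSkewBipyramid hR⟩
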